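/- **Model.** An anonymous dynamic network consists of a finite set $V$ of $n\ge 1$ agents and undirected multigraphs $G_1,G_2,\dots$ on $V$; it is connected if every $G_t$ is connected. Every agent has an input that it can always read. In round $t\ge1$ every agent sends one message, a function of its input and its state, through all its incident links in $G_t$, receives the multiset of its neighbors' messages, updates its state as a function of its input, its state and this multiset, and returns an output that is a function of its input and its new state; the functions are the same for all agents and do not depend on $n$. **Views.** Views over an input set $I$ are (up to isomorphism) defined recursively. A view of height $1$ is a root with a single child, labeled by an element of $I$. A view of height $k+1$ is obtained from a view of height $k$ and a finite multiset of views of height $k$: match-and-merge the latter into the former, add a new child, labeled by an element of $I$, to the bottom node of the former (this is the new bottom node), and add a red edge to it from the bottom node of each view of the multiset (with multiplicity). So the height is the number of levels $L_0,\dots,L_{k-1}$ below the root. *Chopping* a view of height at least $2$ deletes level $L_0$, attaches the nodes of $L_1$ to the root, and merges nodes with isomorphic sub-views, level by level, adding the multiplicities of their outgoing red edges. **Memory.** The memory of an agent either encodes a pair $(\mathcal V,b)$ of a view and a flag $b\in\{0,1\}$, or it is ill-formed. The *garbage coefficient* of an agent is the height of the view encoded by its initial memory, or $0$ if that memory is ill-formed.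 **Theorem.** For every set $I$ of inputs there is an algorithm, independent of $n$, with the following two properties. 1. In every round, an agent with input $x$ whose memory is ill-formed first resets it to the pair consisting of the view of height $1$ with label $x$ and the flag $0$. It sends its pair to all its neighbors. Among its own pair and the received ones it selects a pair $(\mathcal V^*,b^*)$ whose view has minimum height, chops its own view and all received views down to this height, and forms from them its new view, with new bottom label $x$. Its new flag is $1-b^*$; if this is $0$, the new view is chopped once. (So views are chopped once every two rounds, synchronized by the flags.) 2. It is self-stabilizing and universal: in every connected anonymous dynamic network of any size $n\ge 1$, for all inputs and all initial memories of the agents, at the end of every round $t\ge\max\{4n-2h,\,2h\}$ every agent outputs the Input Frequency function (which assigns to each $x\in I$ the fraction of agents whose input is $x$), where $h$ is the minimum garbage coefficient of all agents. -/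

import Mathlib

universe u v w

/-! ### Anonymous dynamic networks -/

/-- A finite undirected multigraph: `mult p q` is the number of links between `p` and `q`
(parallel links and self-loops are allowed). -/
structure Multigraph (V : Type v) where
  mult : V → V → ℕ
  symm : ∀ p q, mult p q = mult q p

namespace Multigraph

variable {V : Type v}

/-- The multigraph is connected (in particular it has at least one vertex). -/
def Connected (G : Multigraph V) : Prop :=
  (SimpleGraph.fromRel fun p q => 0 < G.mult p q).Connected

/-- The multiset of messages received by `p` if every agent `q` sends `msg q` through all its
incident links. -/
def received [Fintype V] {M : Type w} (G : Multigraph V) (msg : V → M) (p : V) : Multiset M :=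
  ∑ q, G.mult p q • ({msg q} : Multiset M)

end Multigraph

/-- A local algorithm, the same for all (anonymous) agents, for inputs in `I`, internal states in
`S`, messages in `M` and outputs in `O`. An agent can always read its own input. -/
structure Algorithm (I : Type*) (S : Type*) (M : Type*) (O : Type*) where
  /-- the message sent to all neighbors -/
  send : I → S → M
  /-- the new state, from the current state and the multiset of received messages -/
  step : I → S → Multiset M → S
  /-- the output returned at the end of a round -/
  out : I → S → O

/-- The state of every agent at the end of round `t`, if the initial states are `s₀`; here `G t` is
the communication graph of round `t + 1`. -/
def Algorithm.run {I S M O : Type*} (A : Algorithm I S M O) {V : Type v} [Fintype V]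
    (G : ℕ → Multigraph V) (input : V → I) (s₀ : V → S) : ℕ → V → S
  | 0 => s₀
  | t + 1 => fun p => A.step (input p) (A.run G input s₀ t p)
      ((G t).received (fun q => A.send (input q) (A.run G input s₀ t q)) p)

/-- The Input Frequency function: the fraction of agents that have each input value. -/
noncomputable def inputFrequency {V : Type v} {I : Type u} (input : V → I) : I → ℚ :=
  fun x => (Nat.card {p : V // input p = x} : ℚ) / (Nat.card V : ℚ)

/-! ### Views of history trees -/

/-- Views of history trees whose bottom node lies in level `L_k`, up to isomorphism.

A view is determined by its bottom node's label, the sub-view at the parent of the bottom node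
(along the black edge), and the multiset of the sub-views at the sources of the red edges entering
the bottom node (with their multiplicities). The nodes of level `L_i` are the distinct sub-views of
index `i` that occur, since nodes with isomorphic sub-views are merged; the node of a view with
index `0` is attached to the root, which is left implicit. -/
def LevelView (I : Type u) : ℕ → Type u
  | 0 => I
  | k + 1 => I × LevelView I k × Multiset (LevelView I k)

namespace LevelView

variable {I : Type u}

/-- Update of the view `own` of an agent with input `x`: the bottom node gets a child labeled `x`,
the views in `rec` are match-and-merged into `own`, and each of their bottom nodes gets a red edge
to the new bottom node. -/
def extend {k : ℕ} (x : I) (own : LevelView I k) (rec : Multiset (LevelView I k)) :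
    LevelView I (k + 1) :=
  (x, own, rec)

/-- The chop operation: level `L_0` is deleted, the nodes of `L_1` are attached to the root, and
then nodes with isomorphic sub-views are merged, adding the multiplicities of their outgoing red
edges (this is what mapping a multiset of sub-views does). -/
def chop : {k : ℕ} → LevelView I (k + 1) → LevelView I k
  | 0, (x, _, _) => x
  | _ + 1, (x, own, rec) => (x, chop own, rec.map chop)

/-- Chop a view repeatedly, until its bottom node lies in level `L_k`. -/
def trim {k m : ℕ} (h : k ≤ m) : LevelView I m → LevelView I k :=
  Nat.leRec (motive := fun m _ => LevelView I m → LevelView I k)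
    (fun V => V) (fun _ _ f V => f (chop V)) h

end LevelView

/-- A (well-formed) view of a history tree, of any height. -/
def View (I : Type u) : Type u := Σ k, LevelView I k

namespace View

variable {I : Type u}

/-- The height of a view: the length of a path from the root to the bottom node, that is, the
number of its levels `L_0, …, L_k`. -/
def height (V : View I) : ℕ := V.1 + 1

/-- The view with two nodes: a root with a single child labeled `x`. -/
def initial (x : I) : View I := ⟨0, x⟩

end View

/-! ### The view-chopping algorithms -/

/-- The possible contents of an agent's memory: either a well-formed view together with a binary
flag, or something in `J` that does not encode such a pair. -/
abbrev Memory (I : Type u) (J : Type w) := (View I × Bool) ⊕ J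

namespace Memory

variable {I : Type u} {J : Type w}

/-- The garbage coefficient of an agent with the given initial memory. -/
def garbage : Memory I J → ℕ
  | .inl (V, _) => V.height
  | .inr _ => 0

/-- An ill-formed memory of an agent with input `x` is reset to the two-node view with flag `0`. -/
def reset (x : I) : Memory I J → View I × Bool
  | .inl P => P
  | .inr _ => (View.initial x, false)

end Memory

/-- The algorithm works by chopping views once every two rounds, synchronized by a binary flag.

Every agent first resets its memory if it is ill-formed, and sends its pair (view, flag) to all its
neighbors. It then selects a pair `(V, b)` whose view has minimum height among its own pair and the
received ones, chops its own view and all received views to that height, and updates its own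
view with the received ones. Its new flag is `1 - b`, and if this is `0` the resulting view is
chopped once. (Flags: `false` is `0`, `true` is `1`.) -/
def Algorithm.ChopsViews {I : Type u} {J : Type w} {O : Type*}
    (A : Algorithm I (Memory I J) (View I × Bool) O) : Prop :=
  (∀ x s, A.send x s = s.reset x) ∧
  ∀ (x : I) (s : Memory I J) (rec : Multiset (View I × Bool)),
    ∃ (V : View I) (b : Bool), (V, b) ∈ s.reset x ::ₘ rec ∧
      ∃ (hown : V.1 ≤ (s.reset x).1.1) (hrec : ∀ P ∈ rec, V.1 ≤ P.1.1),
        let new : LevelView I (V.1 + 1) := LevelView.extend x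
          (LevelView.trim hown (s.reset x).1.2)
          (rec.pmap (fun P (h : V.1 ≤ P.1.1) => LevelView.trim h P.1.2) hrec)
        A.step x s rec = .inl (match b with
          | false => (⟨V.1 + 1, new⟩, true)
          | true => (⟨V.1, new.chop⟩, false))

/-! Two things must hold at round `t`: every view is free of garbage, and it is tall enough to
determine the frequencies. Chopping commutes with extending, so a view of height at most `t` is the
view that its agent would have after a fresh start during the run (`trim_pairAfter`). For heights,
let `progress` be about twice the height, adjusted by the flag. If ties in height are broken by
`progress`, an agent's new value is one more than the minimum over itself and its neighbors. Up to
the drift `t`, minima spread like a flood, so after `n - 1` rounds all values lie near `2h + t`.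
This puts all heights between `2n` and `t`. A clean view of height at least `2n` suffices
(`inputFrequency_eq_of_networkView_eq`). Some level among the first `n` does not branch, and the
next one is entirely visible. There the red edges determine the ratios of class sizes by counting
links between classes from both ends. Hence the output can be any frequency function that `Explains`
the view, without knowledge of `n`. -/

/-! ### Spreading along connected multigraphs -/

namespace Multigraph

variable {V : Type v}

/-- A nonempty proper set of vertices of a connected multigraph has an outgoing link. -/
theorem Connected.exists_link {G : Multigraph V} (hG : G.Connected) {R : Set V}
    (hne : R.Nonempty) (hR : R ≠ Set.univ) : ∃ q ∈ R, ∃ p ∉ R, 0 < G.mult p q := by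
  by_contra! hcon
  obtain ⟨q, hq⟩ := hne
  refine hR (Set.eq_univ_of_forall fun p => ?_)
  obtain ⟨walk⟩ := hG.preconnected q p
  induction walk with
  | nil => exact hq
  | @cons a b c hab _ ih =>
    refine ih ?_
    by_contra hb
    have h0 := hcon a hq b hb
    rw [SimpleGraph.fromRel_adj] at hab
    have := G.symm a b
    omega

variable [Fintype V]

theorem received_eq_map {M : Type*} (G : Multigraph V) (msg : V → M) (p : V) :
    G.received msg p = (G.received id p).map msg := by
  rw [received, received, ← Multiset.coe_mapAddMonoidHom, map_sum]
  simp [map_nsmul]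

theorem mem_received_id {G : Multigraph V} {p q : V} :
    q ∈ G.received id p ↔ 0 < G.mult p q := by
  simp [received, Multiset.mem_sum, Multiset.mem_nsmul, Nat.pos_iff_ne_zero]

theorem mem_received {M : Type*} {G : Multigraph V} {msg : V → M} {p : V} {m : M} :
    m ∈ G.received msg p ↔ ∃ q, 0 < G.mult p q ∧ msg q = m := by
  rw [received_eq_map, Multiset.mem_map]
  simp only [mem_received_id]

theorem count_received {M : Type*} [DecidableEq M] (G : Multigraph V) (msg : V → M) (p : V)
    (m : M) : (G.received msg p).count m = ∑ q with msg q = m, G.mult p q := by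
  rw [received, Multiset.count_sum', Finset.sum_filter]
  refine Finset.sum_congr rfl fun q _ => ?_
  rw [Multiset.count_nsmul, Multiset.count_singleton]
  by_cases h : msg q = m
  · simp [h]
  · simp [h, Ne.symm h]

theorem pmap_received {M N : Type*} {P : M → Prop} {G : Multigraph V} {msg : V → M} {p : V}
    {f : ∀ m, P m → N} {g : V → N} (H : ∀ m ∈ G.received msg p, P m)
    (hfg : ∀ q (h : P (msg q)), f (msg q) h = g q) :
    (G.received msg p).pmap f H = G.received g p := by
  revert H
  rw [received_eq_map]
  intro H
  rw [received_eq_map G g]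
  generalize G.received id p = R at H
  induction R using Multiset.induction with
  | empty => rfl
  | cons q R ih =>
    simp only [Multiset.map_cons, Multiset.pmap_cons, hfg]
    rw [ih]

/-- Information held by some agent reaches all `n` agents of a connected dynamic network within
`n - 1` rounds. -/
theorem mem_of_spread {G : ℕ → Multigraph V} (hG : ∀ t, (G t).Connected) (R : ℕ → Set V)
    (h0 : (R 0).Nonempty) (hmono : ∀ t, R t ⊆ R (t + 1))
    (hlink : ∀ t, ∀ q ∈ R t, ∀ p, 0 < (G t).mult p q → p ∈ R (t + 1))
    {t : ℕ} (ht : Fintype.card V ≤ t + 1) (p : V) : p ∈ R t := by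
  -- Until it is full, the set gains a vertex in every round.
  have hcard : ∀ t, R t = Set.univ ∨ t + 1 ≤ (R t).ncard := by
    intro t
    induction t with
    | zero => exact Or.inr ((Set.ncard_pos (Set.toFinite _)).2 h0)
    | succ t ih =>
      by_cases hR : R t = Set.univ
      · exact Or.inl (Set.univ_subset_iff.1 (hR ▸ hmono t))
      · have h := ih.resolve_left hR
        have hne : (R t).Nonempty := (Set.ncard_pos (Set.toFinite _)).1 (by omega)
        obtain ⟨q, hq, p, hp, hpq⟩ := (hG t).exists_link hne hR
        have hlt : (R t).ncard < (R (t + 1)).ncard :=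
          Set.ncard_lt_ncard ((Set.ssubset_iff_of_subset (hmono t)).2
            ⟨p, hlink t q hq p hpq, hp⟩) (Set.toFinite _)
        exact Or.inr (by omega)
  have huniv : R t = Set.univ := by
    refine (hcard t).elim id fun h => ?_
    refine Set.eq_of_subset_of_ncard_le (Set.subset_univ _) ?_ (Set.toFinite _)
    rw [Set.ncard_univ, Nat.card_eq_fintype_card]
    omega
  exact huniv ▸ Set.mem_univ p

end Multigraph

/-! ### Counting classes of indistinguishable agents -/

section Counting

variable {V : Type v} [Fintype V] {X : Type*} [DecidableEq X]

/-- The number of links between two classes is symmetric. -/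
theorem Multigraph.card_class_mul_count (G : Multigraph V) (f : V → X) (ρ : X → Multiset X)
    (hρ : ∀ p, G.received f p = ρ (f p)) (x y : X) :
    Fintype.card {p // f p = x} * (ρ x).count y = Fintype.card {p // f p = y} * (ρ y).count x := by
  have key : ∀ x y, Fintype.card {p // f p = x} * (ρ x).count y =
      ∑ p with f p = x, ∑ q with f q = y, G.mult p q := by
    intro x y
    rw [Fintype.card_subtype, ← smul_eq_mul, ← Finset.sum_const]
    refine Finset.sum_congr rfl fun p hp => ?_
    rw [← G.count_received, hρ, (Finset.mem_filter.1 hp).2]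
  rw [key, key, Finset.sum_comm]
  exact Finset.sum_congr rfl fun q _ => Finset.sum_congr rfl fun p _ => G.symm p q

variable {V' : Type*} [Fintype V']

/-- Class sizes are determined up to a common factor by the numbers of links that lead from an
agent of one class to another class. -/
theorem Multigraph.card_class_proportional {G : Multigraph V} (hG : G.Connected)
    (G' : Multigraph V') (f : V → X) (f' : V' → X) (ρ : X → Multiset X)
    (hρ : ∀ p, G.received f p = ρ (f p)) (hρ' : ∀ p, G'.received f' p = ρ (f' p)) (p q : V) :
    Fintype.card {r // f' r = f p} * Fintype.card {r // f r = f q} =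
      Fintype.card {r // f r = f p} * Fintype.card {r // f' r = f q} := by
  have hpos : ∀ p, 0 < Fintype.card {r // f r = f p} := fun p =>
    Fintype.card_pos_iff.2 ⟨⟨p, rfl⟩⟩
  obtain ⟨walk⟩ := hG.preconnected p q
  induction walk with
  | nil => exact Nat.mul_comm _ _
  | @cons a b c hab _ ih =>
    have hlink : 0 < G.mult a b := by
      rw [SimpleGraph.fromRel_adj] at hab
      have := G.symm a b
      omega
    have hcount : 0 < (ρ (f a)).count (f b) := by
      rw [← hρ, Multiset.count_pos]
      exact Multigraph.mem_received.2 ⟨b, hlink, rfl⟩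
    have hcount' : 0 < (ρ (f b)).count (f a) := by
      rw [← hρ, Multiset.count_pos]
      exact Multigraph.mem_received.2 ⟨a, G.symm a b ▸ hlink, rfl⟩
    have h := G.card_class_mul_count f ρ hρ (f a) (f b)
    have h' := G'.card_class_mul_count f' ρ hρ' (f a) (f b)
    -- Both networks have the same link counts per agent, so the two balance equations give the same
    -- ratio for adjacent classes; the counts are positive and cancel.
    have hab : Fintype.card {r // f' r = f a} * Fintype.card {r // f r = f b} =
        Fintype.card {r // f r = f a} * Fintype.card {r // f' r = f b} := by
      refine Nat.eq_of_mul_eq_mul_right (Nat.mul_pos hcount hcount') ?_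
      calc _ = (Fintype.card {r // f' r = f a} * (ρ (f a)).count (f b)) *
            (Fintype.card {r // f r = f b} * (ρ (f b)).count (f a)) := by ring
        _ = (Fintype.card {r // f' r = f b} * (ρ (f b)).count (f a)) *
            (Fintype.card {r // f r = f a} * (ρ (f a)).count (f b)) := by rw [h, h']
        _ = _ := by ring
    refine Nat.eq_of_mul_eq_mul_right (hpos b) ?_
    calc _ = (Fintype.card {r // f' r = f a} * Fintype.card {r // f r = f b}) *
          Fintype.card {r // f r = f c} := by ring
      _ = Fintype.card {r // f r = f a} *
          (Fintype.card {r // f' r = f b} * Fintype.card {r // f r = f c}) := by rw [hab]; ring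
      _ = _ := by rw [ih]; ring

/-- Summing `hprop` over the classes with label `x` on one side and over all classes on the other
gives the cross-multiplied equality of the two fractions. -/
theorem inputFrequency_eq_of_card_class_proportional {I : Type u} [Nonempty V]
    (f : V → X) (f' : V' → X) (label : X → I) (hrange : Set.range f = Set.range f')
    (hprop : ∀ p q : V, Fintype.card {r // f' r = f p} * Fintype.card {r // f r = f q} =
      Fintype.card {r // f r = f p} * Fintype.card {r // f' r = f q}) :
    inputFrequency (fun p => label (f p)) = inputFrequency (fun p => label (f' p)) := by
  classical
  funext x
  have : Nonempty V' := by
    obtain ⟨p⟩ := ‹Nonempty V›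
    obtain ⟨p', _⟩ : f p ∈ Set.range f' := hrange ▸ Set.mem_range_self p
    exact ⟨p'⟩
  set S := Finset.univ.image f
  have hmem : ∀ p, f p ∈ S := fun p => Finset.mem_image_of_mem f (Finset.mem_univ p)
  have hmem' : ∀ p, f' p ∈ S := fun p => by
    obtain ⟨q, hq⟩ : f' p ∈ Set.range f := hrange ▸ Set.mem_range_self p
    exact hq ▸ hmem q
  have htotal : ∑ y ∈ S, Fintype.card {r // f r = y} = Fintype.card V := by
    simp_rw [Fintype.card_subtype]
    exact (Finset.card_eq_sum_card_fiberwise fun p _ => hmem p).symm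
  have htotal' : ∑ y ∈ S, Fintype.card {r // f' r = y} = Fintype.card V' := by
    simp_rw [Fintype.card_subtype]
    exact (Finset.card_eq_sum_card_fiberwise fun p _ => hmem' p).symm
  have hpart : ∑ y ∈ S with label y = x, Fintype.card {r // f r = y} =
      Fintype.card {p // label (f p) = x} := by
    simp_rw [Fintype.card_subtype]
    rw [Finset.card_eq_sum_card_fiberwise (f := f) (t := S.filter fun y => label y = x)
      (fun p hp => by simpa [hmem p] using hp)]
    refine Finset.sum_congr rfl fun y hy => congrArg _ ?_
    ext p
    have := (Finset.mem_filter.1 hy).2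
    simp only [Finset.mem_filter, Finset.mem_univ, true_and]
    exact ⟨fun h => ⟨h ▸ this, h⟩, fun h => h.2⟩
  have hpart' : ∑ y ∈ S with label y = x, Fintype.card {r // f' r = y} =
      Fintype.card {p // label (f' p) = x} := by
    simp_rw [Fintype.card_subtype]
    rw [Finset.card_eq_sum_card_fiberwise (f := f') (t := S.filter fun y => label y = x)
      (fun p hp => by simpa [hmem' p] using hp)]
    refine Finset.sum_congr rfl fun y hy => congrArg _ ?_
    ext p
    have := (Finset.mem_filter.1 hy).2
    simp only [Finset.mem_filter, Finset.mem_univ, true_and]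
    exact ⟨fun h => ⟨h ▸ this, h⟩, fun h => h.2⟩
  have hcross : Fintype.card {p // label (f p) = x} * Fintype.card V' =
      Fintype.card {p // label (f' p) = x} * Fintype.card V := by
    rw [← hpart, ← hpart', ← htotal, ← htotal', Finset.sum_mul_sum, Finset.sum_mul_sum]
    refine Finset.sum_congr rfl fun y hy => Finset.sum_congr rfl fun z hz => ?_
    obtain ⟨p, -, rfl⟩ := Finset.mem_image.1 (Finset.mem_filter.1 hy).1
    obtain ⟨q, -, rfl⟩ := Finset.mem_image.1 hz
    exact (hprop p q).symm
  have hV : (Fintype.card V : ℚ) ≠ 0 := Nat.cast_ne_zero.2 Fintype.card_ne_zero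
  have hV' : (Fintype.card V' : ℚ) ≠ 0 := Nat.cast_ne_zero.2 Fintype.card_ne_zero
  simp only [inputFrequency, Nat.card_eq_fintype_card]
  rw [div_eq_div_iff hV hV']
  exact_mod_cast hcross

end Counting

/-! ### Views of a network -/

/-- The view of agent `p` after `k` rounds of a network in which all agents start afresh. -/
def networkView {V : Type v} [Fintype V] {I : Type u} (G : ℕ → Multigraph V) (input : V → I) :
    (k : ℕ) → V → LevelView I k
  | 0 => input
  | k + 1 => fun p => LevelView.extend (input p) (networkView G input k p)
      ((G k).received (networkView G input k) p)

namespace LevelView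

variable {I : Type u}

/-- The sub-view at the parent of the bottom node. -/
def parent {k : ℕ} : LevelView I (k + 1) → LevelView I k
  | (_, own, _) => own

/-- The sub-views whose bottom nodes lie in level `L_i`. -/
def subviews {i : ℕ} : (d : ℕ) → LevelView I (i + d) → Set (LevelView I i)
  | 0, W => {W}
  | d + 1, (_, own, rec) => {U | U ∈ subviews d own ∨ ∃ W ∈ rec, U ∈ subviews d W}

theorem mem_subviews_extend {i d : ℕ} {x : I} {own : LevelView I (i + d)}
    {rec : Multiset (LevelView I (i + d))} {U : LevelView I i} :
    U ∈ subviews (d + 1) (extend x own rec : LevelView I (i + d + 1)) ↔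
      U ∈ subviews d own ∨ ∃ W ∈ rec, U ∈ subviews d W :=
  Iff.rfl

@[simp]
theorem trim_self {k : ℕ} (h : k ≤ k) (W : LevelView I k) : trim h W = W := by
  simp [trim, Nat.leRec_self]

theorem trim_chop {k m : ℕ} (h : k ≤ m) (h' : k ≤ m + 1) (W : LevelView I (m + 1)) :
    trim h (chop W) = trim h' W := by
  simp [trim, Nat.leRec_succ _ _ h]

theorem trim_trim {j k m : ℕ} (hjk : j ≤ k) (hkm : k ≤ m) (W : LevelView I m) :
    trim hjk (trim hkm W) = trim (hjk.trans hkm) W := by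
  induction m, hkm using Nat.le_induction with
  | base => simp
  | succ m hkm ih => rw [← trim_chop hkm, ih, trim_chop]

theorem trim_zero_extend {k : ℕ} (h : 0 ≤ k + 1) (x : I) (own : LevelView I k)
    (rec : Multiset (LevelView I k)) : trim h (extend x own rec) = (x : LevelView I 0) := by
  induction k with
  | zero => rw [← trim_chop (Nat.zero_le 0), trim_self]; rfl
  | succ k ih =>
    rw [← trim_chop (Nat.zero_le (k + 1))]
    exact ih _ (chop own) (rec.map chop)

/-- Chopping commutes with extending. This is why garbage, confined to the top levels, never
contaminates the lower ones. -/
theorem trim_succ_extend {j k : ℕ} (h : j ≤ k) (h' : j + 1 ≤ k + 1) (x : I)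
    (own : LevelView I k) (rec : Multiset (LevelView I k)) :
    trim h' (extend x own rec) = extend x (trim h own) (rec.map (trim h)) := by
  induction k, h using Nat.le_induction with
  | base =>
    rw [trim_self, trim_self, Multiset.map_congr rfl fun W _ => trim_self _ W, Multiset.map_id']
  | succ k h ih =>
    rw [← trim_chop (Nat.succ_le_succ h)]
    refine (ih (Nat.succ_le_succ h) (chop own) (rec.map chop)).trans ?_
    rw [Multiset.map_map, trim_chop]
    exact congrArg _ (Multiset.map_congr rfl fun W _ => trim_chop _ _ W)

end LevelView

section NetworkView

variable {V : Type v} [Fintype V] {I : Type u} {G : ℕ → Multigraph V} {input : V → I}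

theorem networkView_succ (k : ℕ) (p : V) : networkView G input (k + 1) p =
    LevelView.extend (input p) (networkView G input k p)
      ((G k).received (networkView G input k) p) :=
  rfl

theorem exists_of_mem_subviews_networkView {i d : ℕ} {p : V} {U : LevelView I i}
    (h : U ∈ LevelView.subviews d (networkView G input (i + d) p)) :
    ∃ q, networkView G input i q = U := by
  induction d generalizing p with
  | zero => exact ⟨p, (Set.mem_singleton_iff.1 h).symm⟩
  | succ d ih =>
    obtain h | ⟨W, hW, h⟩ := LevelView.mem_subviews_extend.1 h
    · exact ih h
    · obtain ⟨q, -, rfl⟩ := Multigraph.mem_received.1 hW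
      exact ih h

/-- After `n - 1` further rounds, all nodes of level `L_i` are visible to every agent. -/
theorem subviews_networkView (hG : ∀ t, (G t).Connected) {i d : ℕ}
    (hd : Fintype.card V ≤ d + 1) (p : V) :
    LevelView.subviews d (networkView G input (i + d) p) = Set.range (networkView G input i) := by
  refine Set.Subset.antisymm (fun U => exists_of_mem_subviews_networkView) ?_
  rintro _ ⟨q, rfl⟩
  refine Multigraph.mem_of_spread (fun t => hG (i + t))
    (fun d => {p | networkView G input i q ∈
      LevelView.subviews d (networkView G input (i + d) p)})
    ⟨q, Set.mem_singleton _⟩ (fun t p hp => ?_) (fun t r hr p hpr => ?_) hd p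
  · exact (LevelView.mem_subviews_extend (x := input p)).2 (Or.inl hp)
  · exact (LevelView.mem_subviews_extend (x := input p)).2
      (Or.inr ⟨_, Multigraph.mem_received.2 ⟨r, hpr, rfl⟩, hr⟩)

/-- Among the first `n` levels there is one whose nodes do not branch. -/
theorem exists_nonbranching_level (G : ℕ → Multigraph V) (input : V → I) [Nonempty V] :
    ∃ i < Fintype.card V, ∀ p q, networkView G input i p = networkView G input i q →
      networkView G input (i + 1) p = networkView G input (i + 1) q := by
  classical
  by_contra! hcon
  have hcard : ∀ i ≤ Fintype.card V,
      i + 1 ≤ (Finset.univ.image (networkView G input i)).card := by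
    intro i hi
    induction i with
    | zero => exact Finset.card_pos.2 (Finset.univ_nonempty.image _)
    | succ i ih =>
      refine (Nat.succ_le_succ (ih (by omega))).trans (Nat.succ_le_of_lt ?_)
      obtain ⟨p, q, hpq, hne⟩ := hcon i (by omega)
      -- `parent` maps level `i + 1` onto level `i`. Equal sizes would make it injective, which a
      -- branching node excludes.
      have himage : (Finset.univ.image (networkView G input (i + 1))).image
          LevelView.parent =
          Finset.univ.image (networkView G input i) := by
        rw [Finset.image_image]
        rfl
      rw [← himage]
      refine lt_of_le_of_ne Finset.card_image_le fun heq => hne ?_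
      exact Finset.card_image_iff.1 heq
        (Finset.mem_coe.2 (Finset.mem_image_of_mem _ (Finset.mem_univ p)))
        (Finset.mem_coe.2 (Finset.mem_image_of_mem _ (Finset.mem_univ q))) hpq
  have h := (hcard _ le_rfl).trans Finset.card_image_le
  rw [Finset.card_univ] at h
  omega

/-- Two networks have the same input frequencies if some view, of height at least twice the size
of each of them, occurs in both. -/
theorem inputFrequency_eq_of_networkView_eq {V' : Type*} [Fintype V'] {G' : ℕ → Multigraph V'}
    {input' : V' → I} (hG : ∀ t, (G t).Connected) (hG' : ∀ t, (G' t).Connected) {k : ℕ}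
    (hk : 2 * Fintype.card V ≤ k + 1) (hk' : 2 * Fintype.card V' ≤ k + 1) {p : V} {p' : V'}
    (h : networkView G input k p = networkView G' input' k p') :
    inputFrequency input = inputFrequency input' := by
  classical
  have : Nonempty V := ⟨p⟩
  obtain ⟨i, hi, hinj⟩ := exists_nonbranching_level G input
  -- Since `i` is less than half of `k + 1`, at least `n - 1` rounds remain below level `i + 1` for
  -- either network size `n`.
  obtain ⟨d, rfl⟩ : ∃ d, k = i + 1 + d := Nat.exists_eq_add_of_le (by omega)
  have hrange : Set.range (networkView G input (i + 1)) =
      Set.range (networkView G' input' (i + 1)) := by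
    rw [← subviews_networkView hG (by omega : Fintype.card V ≤ d + 1) p,
      ← subviews_networkView hG' (by omega : Fintype.card V' ≤ d + 1) p', h]
  have hrange_own : Set.range (networkView G input i) = Set.range (networkView G' input' i) := by
    have := congrArg (LevelView.parent '' ·) hrange
    simp only [← Set.range_comp] at this
    exact this
  -- `σ` sends a node of the non-branching level to its only child; the default value is never used.
  let σ : LevelView I i → I × LevelView I i × Multiset (LevelView I i) :=
    Function.extend (networkView G input i) (networkView G input (i + 1))
      fun _ => networkView G input (i + 1) p
  have hσ : ∀ q, σ (networkView G input i q) = networkView G input (i + 1) q := fun q =>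
    Function.FactorsThrough.extend_apply (fun a b => hinj a b) _ q
  -- The second network has the same nodes in level `i + 1`, so its level `i` does not branch
  -- either.
  have hσ' : ∀ q, σ (networkView G' input' i q) = networkView G' input' (i + 1) q := by
    intro q
    obtain ⟨r, hr⟩ : networkView G' input' (i + 1) q ∈ Set.range (networkView G input (i + 1)) :=
      hrange ▸ Set.mem_range_self q
    have hown : networkView G input i r = networkView G' input' i q := congrArg LevelView.parent hr
    rw [← hown, hσ, hr]
  have hfreq := inputFrequency_eq_of_card_class_proportional
    (networkView G input i) (networkView G' input' i) (fun W => (σ W).1) hrange_own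
    (Multigraph.card_class_proportional (hG i) (G' i) _ _ (fun W => (σ W).2.2)
      (fun q => by rw [hσ]; rfl) (fun q => by rw [hσ']; rfl))
  have hlabel : (fun q => (σ (networkView G input i q)).1) = input :=
    funext fun q => by rw [hσ]; rfl
  have hlabel' : (fun q => (σ (networkView G' input' i q)).1) = input' :=
    funext fun q => by rw [hσ']; rfl
  rwa [hlabel, hlabel'] at hfreq

end NetworkView

/-! ### The algorithm -/

/-- A measure of the progress of an agent, refining the height of its view: it grows by `1` when
the view is extended with flag `0` (so that the height grows), and also when it is extended and
chopped with flag `1` (so that only the flag changes). -/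
def progress {I : Type u} (P : View I × Bool) : ℕ :=
  2 * P.1.1 + cond P.2 1 2

theorem index_le_of_progress_le {I : Type u} {P Q : View I × Bool}
    (h : progress P ≤ progress Q) : P.1.1 ≤ Q.1.1 := by
  obtain ⟨P, _ | _⟩ := P <;> obtain ⟨Q, _ | _⟩ := Q <;> simp [progress] at h ⊢ <;> omega

theorem exists_min_progress {I : Type u} (P : View I × Bool) (rec : Multiset (View I × Bool)) :
    ∃ S ∈ P ::ₘ rec, ∀ Q ∈ P ::ₘ rec, progress S ≤ progress Q := by
  obtain ⟨S, hS, hmin⟩ := Set.exists_min_image {Q | Q ∈ P ::ₘ rec} progress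
    (Multiset.finite_toSet _) ⟨P, Multiset.mem_cons_self P rec⟩
  exact ⟨S, hS, hmin⟩

/-- The selected pair: its view has minimum height, and if possible its flag is `1`. -/
noncomputable def select {I : Type u} (P : View I × Bool) (rec : Multiset (View I × Bool)) :
    View I × Bool :=
  (exists_min_progress P rec).choose

theorem select_mem {I : Type u} (P : View I × Bool) (rec : Multiset (View I × Bool)) :
    select P rec ∈ P ::ₘ rec :=
  (exists_min_progress P rec).choose_spec.1

theorem progress_select_le {I : Type u} {P Q : View I × Bool} {rec : Multiset (View I × Bool)}
    (h : Q ∈ P ::ₘ rec) : progress (select P rec) ≤ progress Q :=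
  (exists_min_progress P rec).choose_spec.2 Q h

theorem select_index_le_own {I : Type u} (P : View I × Bool) (rec : Multiset (View I × Bool)) :
    (select P rec).1.1 ≤ P.1.1 :=
  index_le_of_progress_le (progress_select_le (Multiset.mem_cons_self P rec))

theorem select_index_le {I : Type u} (P : View I × Bool) (rec : Multiset (View I × Bool)) :
    ∀ Q ∈ rec, (select P rec).1.1 ≤ Q.1.1 :=
  fun _ hQ => index_le_of_progress_le (progress_select_le (Multiset.mem_cons_of_mem hQ))

/-- The own view and the received ones, chopped to minimum height and joined. -/
noncomputable def joinedView {I : Type u} (x : I) (P : View I × Bool)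
    (rec : Multiset (View I × Bool)) : LevelView I ((select P rec).1.1 + 1) :=
  LevelView.extend x (LevelView.trim (select_index_le_own P rec) P.1.2)
    (rec.pmap (fun Q (h : (select P rec).1.1 ≤ Q.1.1) => LevelView.trim h Q.1.2)
      (select_index_le P rec))

/-- The pair of an agent with input `x` and pair `P` after it has received the pairs in `rec`. -/
noncomputable def nextPair {I : Type u} (x : I) (P : View I × Bool)
    (rec : Multiset (View I × Bool)) : View I × Bool :=
  match (select P rec).2 with
  | false => (⟨(select P rec).1.1 + 1, joinedView x P rec⟩, true)
  | true => (⟨(select P rec).1.1, (joinedView x P rec).chop⟩, false)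

theorem progress_nextPair {I : Type u} (x : I) (P : View I × Bool)
    (rec : Multiset (View I × Bool)) :
    progress (nextPair x P rec) = progress (select P rec) + 1 := by
  unfold nextPair progress
  cases (select P rec).2 <;> simp [Nat.mul_add]

/-- The new view is the joined view, possibly chopped. -/
theorem trim_nextPair {I : Type u} (x : I) (P : View I × Bool) (rec : Multiset (View I × Bool))
    {j : ℕ} (hj : j ≤ (nextPair x P rec).1.1) :
    ∃ h : j ≤ (select P rec).1.1 + 1,
      LevelView.trim hj (nextPair x P rec).1.2 = LevelView.trim h (joinedView x P rec) := by
  revert hj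
  unfold nextPair
  cases (select P rec).2 with
  | false => exact fun hj => ⟨hj, rfl⟩
  | true => exact fun hj => ⟨Nat.le_succ_of_le hj, LevelView.trim_chop _ _ _⟩

/-- The input frequencies `F` occur in a connected network with at most half as many agents as the
height of `W`, some agent of which has the view `W`. -/
def Explains {I : Type u} (W : View I) (F : I → ℚ) : Prop :=
  ∃ (V : Type v) (_ : Fintype V) (G : ℕ → Multigraph V) (input : V → I) (p : V),
    (∀ t, (G t).Connected) ∧ 2 * Fintype.card V ≤ W.height ∧
      W.2 = networkView G input W.1 p ∧ F = inputFrequency input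

theorem Explains.unique {I : Type u} {W : View I} {F F' : I → ℚ} (h : Explains.{u, v} W F)
    (h' : Explains.{u, v} W F') : F = F' := by
  obtain ⟨V, _, G, input, p, hG, hcard, hW, rfl⟩ := h
  obtain ⟨V', _, G', input', p', hG', hcard', hW', rfl⟩ := h'
  exact inputFrequency_eq_of_networkView_eq hG hG' hcard hcard' (hW.symm.trans hW')

/-- The view-chopping algorithm, which outputs the input frequencies that explain its view. -/
noncomputable def viewChopping (I : Type u) (J : Type w) :
    Algorithm I (Memory I J) (View I × Bool) (I → ℚ) where
  send x s := s.reset x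
  step x s rec := .inl (nextPair x (s.reset x) rec)
  out x s := Classical.epsilon (Explains.{u, v} (s.reset x).1)

theorem viewChopping_chopsViews (I : Type u) (J : Type w) :
    (viewChopping.{u, v, w} I J).ChopsViews := by
  refine ⟨fun _ _ => rfl, fun x s rec => ?_⟩
  refine ⟨(select (s.reset x) rec).1, (select (s.reset x) rec).2, select_mem _ _,
    select_index_le_own _ _, select_index_le _ _, rfl⟩

/-! ### Heights and garbage in a run of the algorithm -/

section Run

variable {I : Type u} {J : Type w} {V : Type v} [Fintype V] {G : ℕ → Multigraph V}
  {input : V → I} {s₀ : V → Memory I J}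

/-- The pair of agent `p` after `t` rounds; an ill-formed initial memory counts as reset. -/
noncomputable def pairAfter (G : ℕ → Multigraph V) (input : V → I) (s₀ : V → Memory I J)
    (t : ℕ) (p : V) : View I × Bool :=
  ((viewChopping.{u, v, w} I J).run G input s₀ t p).reset (input p)

theorem pairAfter_succ (t : ℕ) (p : V) : pairAfter G input s₀ (t + 1) p =
    nextPair (input p) (pairAfter G input s₀ t p) ((G t).received (pairAfter G input s₀ t) p) :=
  rfl

theorem progress_pairAfter_succ_le_self (t : ℕ) (p : V) :
    progress (pairAfter G input s₀ (t + 1) p) ≤ progress (pairAfter G input s₀ t p) + 1 := by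
  rw [pairAfter_succ, progress_nextPair]
  exact Nat.succ_le_succ (progress_select_le (Multiset.mem_cons_self _ _))

theorem progress_pairAfter_succ_le {t : ℕ} {p q : V} (h : 0 < (G t).mult p q) :
    progress (pairAfter G input s₀ (t + 1) p) ≤ progress (pairAfter G input s₀ t q) + 1 := by
  rw [pairAfter_succ, progress_nextPair]
  exact Nat.succ_le_succ (progress_select_le
    (Multiset.mem_cons_of_mem (Multigraph.mem_received.2 ⟨q, h, rfl⟩)))

theorem le_progress_pairAfter {c : ℕ} (hc : ∀ p, c ≤ progress (pairAfter G input s₀ 0 p)) (t : ℕ)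
    (p : V) : c + t ≤ progress (pairAfter G input s₀ t p) := by
  induction t generalizing p with
  | zero => exact hc p
  | succ t ih =>
    rw [pairAfter_succ, progress_nextPair]
    refine Nat.succ_le_succ ?_
    obtain h | h := Multiset.mem_cons.1 (select_mem (pairAfter G input s₀ t p)
      ((G t).received (pairAfter G input s₀ t) p))
    · rw [h]
      exact ih p
    · obtain ⟨q, -, hq⟩ := Multigraph.mem_received.1 h
      exact hq ▸ ih q

theorem progress_pairAfter_le (hG : ∀ t, (G t).Connected) {c : ℕ} {q : V}
    (hq : progress (pairAfter G input s₀ 0 q) ≤ c) {t : ℕ} (ht : Fintype.card V ≤ t + 1) (p : V) :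
    progress (pairAfter G input s₀ t p) ≤ c + t :=
  Multigraph.mem_of_spread hG (fun t => {p | progress (pairAfter G input s₀ t p) ≤ c + t})
    ⟨q, hq⟩
    (fun t p hp => (progress_pairAfter_succ_le_self t p).trans (Nat.succ_le_succ hp))
    (fun _ _ hr _ hpr => (progress_pairAfter_succ_le hpr).trans (Nat.succ_le_succ hr)) ht p

/-- After `t` rounds, the last `t` levels of every view are free from garbage. -/
theorem trim_pairAfter {t : ℕ} {p : V} {a j : ℕ} (hj : j ≤ (pairAfter G input s₀ t p).1.1)
    (ht : a + 1 + j = t) : LevelView.trim hj (pairAfter G input s₀ t p).1.2 =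
      networkView (fun i => G (a + 1 + i)) input j p := by
  induction t generalizing p j with
  | zero => omega
  | succ t ih =>
    simp only [pairAfter_succ] at hj ⊢
    obtain ⟨h, heq⟩ := trim_nextPair _ _ _ hj
    rw [heq]
    -- For `j = 0` only the label written in the current round remains; otherwise induction applies
    -- to the chopped own and received views.
    unfold joinedView
    cases j with
    | zero => exact LevelView.trim_zero_extend _ _ _ _
    | succ j =>
      obtain rfl : a + 1 + j = t := by omega
      rw [LevelView.trim_succ_extend (Nat.le_of_succ_le_succ h), LevelView.trim_trim, ih _ rfl,
        networkView_succ, Multiset.map_pmap]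
      refine congrArg _ (Multigraph.pmap_received _ fun q hq => ?_)
      rw [LevelView.trim_trim, ih _ rfl]

theorem out_viewChopping_run (hG : ∀ t, (G t).Connected) {t : ℕ} {p : V}
    (ht : (pairAfter G input s₀ t p).1.height ≤ t)
    (hn : 2 * Fintype.card V ≤ (pairAfter G input s₀ t p).1.height) :
    (viewChopping.{u, v, w} I J).out (input p)
      ((viewChopping.{u, v, w} I J).run G input s₀ t p) = inputFrequency input := by
  obtain ⟨a, ha⟩ := Nat.exists_eq_add_of_le' ht
  have hexplains : Explains.{u, v} (pairAfter G input s₀ t p).1 (inputFrequency input) := by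
    -- Round `a + 1`, which uses `G a`, contributes only the labels of level `L_0`, so the
    -- explaining network starts with `G (a + 1)`.
    refine ⟨V, inferInstance, fun i => G (a + 1 + i), input, p, fun i => hG _, hn, ?_, rfl⟩
    rw [← trim_pairAfter le_rfl (by rw [View.height] at ha; omega), LevelView.trim_self]
  exact (Classical.epsilon_spec ⟨_, hexplains⟩ : Explains.{u, v} _ _).unique hexplains

theorem le_progress_reset (x : I) (s : Memory I J) :
    2 * s.garbage ≤ progress (s.reset x) + 1 ∧ 1 ≤ progress (s.reset x) := by
  rcases s with ⟨W, _ | _⟩ | j <;>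
    simp [Memory.garbage, Memory.reset, progress, View.height, View.initial] <;> omega

/-- The maximum with `2` covers ill-formed memory: garbage coefficient `0`, but `progress` equal to
`2` after the reset. -/
theorem progress_reset_le (x : I) (s : Memory I J) :
    progress (s.reset x) ≤ max (2 * s.garbage) 2 := by
  rcases s with ⟨W, _ | _⟩ | j <;>
    (simp [Memory.garbage, Memory.reset, progress, View.height, View.initial]; try omega)

theorem height_bounds (P : View I × Bool) :
    progress P ≤ 2 * P.1.height ∧ 2 * P.1.height ≤ progress P + 1 := by
  rcases P with ⟨W, _ | _⟩ <;> simp [progress, View.height] <;> omega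

end Run

theorem theorem2 (I : Type u) (J : Type w) :
    ∃ A : Algorithm I (Memory I J) (View I × Bool) (I → ℚ),
      A.ChopsViews ∧
      ∀ (V : Type v) [Fintype V] (G : ℕ → Multigraph V) (input : V → I) (s₀ : V → Memory I J),
        (∀ t, (G t).Connected) →
        ∀ t : ℕ, max (4 * Fintype.card V - 2 * ⨅ p, (s₀ p).garbage) (2 * ⨅ p, (s₀ p).garbage) ≤ t →
          ∀ p, A.out (input p) (A.run G input s₀ t p) = inputFrequency input := by
  refine ⟨viewChopping.{u, v, w} I J, viewChopping_chopsViews I J, ?_⟩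
  intro V _ G input s₀ hG t ht p
  have : Nonempty V := ⟨p⟩
  obtain ⟨q, hq⟩ := ciInf_mem fun p => (s₀ p).garbage
  have hle : ∀ r, (⨅ p, (s₀ p).garbage) ≤ (s₀ r).garbage := ciInf_le (OrderBot.bddBelow _)
  simp only at hq
  generalize (⨅ p, (s₀ p).garbage) = h at *
  have hn : 0 < Fintype.card V := Fintype.card_pos
  have hupper : progress (pairAfter G input s₀ t p) ≤ max (2 * h) 2 + t :=
    progress_pairAfter_le hG (hq ▸ progress_reset_le (input q) (s₀ q)) (by omega) p
  have hlower : max (2 * h - 1) 1 + t ≤ progress (pairAfter G input s₀ t p) := by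
    refine le_progress_pairAfter (fun r => ?_) t p
    have h₁ := le_progress_reset (input r) (s₀ r)
    have h₂ := hle r
    change _ ≤ progress ((s₀ r).reset (input r))
    omega
  have hbounds := height_bounds (pairAfter G input s₀ t p)
  -- For `h ≥ 1`, `2h + t + 1 ≤ 2t + 1` bounds twice the height from above and `2h - 1 + t ≥ 4n - 1`
  -- from below; parity absorbs the two units. For `h = 0`, `t ≥ 4n` suffices.
  exact out_viewChopping_run hG (by omega) (by omega)
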